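/- Let $c$ be the complex Banach space of convergent sequences $x=(x_k)_{k\ge 0}$ of complex numbers, with the supremum norm $\|\cdot\|_\infty$. Let $T\colon c\to c$ be the Cesàro operator, $(Tx)_k=\frac{1}{k+1}\sum_{j=0}^k x_j$ for $k\ge 0$, and let $Px=x_0\,(1,1,1,\dots)$ for $x\in c$. Let $X$ be the set of all $x\in c$ for which the orbit $(T^nx)_{n\ge 0}$ converges in norm as $n\to\infty$. (a) Suppose that $(r_n)_{n\ge 0}$ is a sequence of positive numbers such that $r_n=o(n^{-1/2})$ as $n\to\infty$. Then there exists $x\in X$ such that the series $\sum_{k=1}^\infty \frac{x_k-x_0}{k}$ converges but $$\limsup_{n\to\infty}\, r_n^{-1}\|T^nx-Px\|_\infty=\infty.$$ (b) Suppose that $(r_n)_{n\ge 0}$ is a sequence of positive numbers such that $r_n\to 0$ as $n\to\infty$. Then there exists $x\in X$ such that $\|T^nx-Px\|_\infty\ge r_n$ for all $n\ge 0$. -/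

import Mathlib

open Filter Topology Asymptotics BoundedContinuousFunction

noncomputable section

namespace CesaroSeq

/-- The space `c` of complex convergent sequences, as a subspace of the bounded sequences `ℕ →ᵇ ℂ`
(a convergent sequence is automatically bounded, see `ofTendsto`). It inherits the supremum norm. -/
def c : Submodule ℂ (ℕ →ᵇ ℂ) where
  carrier := {x | ∃ l : ℂ, Tendsto (fun k => x k) atTop (𝓝 l)}
  add_mem' := by
    rintro x y ⟨a, ha⟩ ⟨b, hb⟩
    exact ⟨a + b, ha.add hb⟩
  zero_mem' := ⟨0, tendsto_const_nhds⟩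
  smul_mem' := by
    rintro t x ⟨a, ha⟩
    exact ⟨t * a, ha.const_mul t⟩

/-- The `k`-th term `x_k` of the sequence `x ∈ c`. -/
def coord (x : c) (k : ℕ) : ℂ := (x : ℕ →ᵇ ℂ) k

/-- Every convergent sequence of complex numbers is an element of `c`. -/
def ofTendsto (f : ℕ → ℂ) (hf : ∃ l : ℂ, Tendsto f atTop (𝓝 l)) : c :=
  ⟨BoundedContinuousFunction.ofNormedAddCommGroupDiscrete f
      (Metric.isBounded_range_of_tendsto f hf.choose_spec).exists_norm_le.choose
      (fun k => (Metric.isBounded_range_of_tendsto f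
        hf.choose_spec).exists_norm_le.choose_spec _ ⟨k, rfl⟩),
    hf⟩

/-- The Cesàro mean `(x_0 + ⋯ + x_k) / (k + 1)`. -/
def mean (f : ℕ → ℂ) (k : ℕ) : ℂ := ((k : ℂ) + 1)⁻¹ * ∑ j ∈ Finset.range (k + 1), f j

theorem tendsto_mean {f : ℕ → ℂ} {l : ℂ} (hf : Tendsto f atTop (𝓝 l)) :
    Tendsto (mean f) atTop (𝓝 l) := by
  have h := (tendsto_add_atTop_iff_nat 1).2 hf.cesaro_smul
  refine h.congr fun k => ?_
  simp [mean]

theorem norm_mean_le {f : ℕ → ℂ} {M : ℝ} (hf : ∀ k, ‖f k‖ ≤ M) (k : ℕ) : ‖mean f k‖ ≤ M := by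
  have h1 : ‖∑ j ∈ Finset.range (k + 1), f j‖ ≤ ((k : ℝ) + 1) * M := by
    refine (norm_sum_le_of_le _ fun j _ => hf j).trans ?_
    simp
  have h2 : ‖((k : ℂ) + 1)‖ = (k : ℝ) + 1 := by
    have := Complex.norm_natCast (k + 1)
    push_cast at this
    exact this
  have h3 : (0 : ℝ) < (k : ℝ) + 1 := by positivity
  rw [mean, norm_mul, norm_inv, h2, inv_mul_le_iff₀ h3]
  exact h1

/-- The Cesàro operator `T : c → c`, `(T x)_k = (x_0 + ⋯ + x_k) / (k + 1)`. -/
def T : c →L[ℂ] c :=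
  LinearMap.mkContinuous
    { toFun := fun x => ofTendsto (mean (coord x))
        (x.2.elim fun l hl => ⟨l, tendsto_mean hl⟩)
      map_add' := by
        intro x y
        ext k
        change mean (coord (x + y)) k = mean (coord x) k + mean (coord y) k
        simp [mean, coord, Finset.sum_add_distrib, mul_add]
      map_smul' := by
        intro t x
        ext k
        change mean (coord (t • x)) k = t * mean (coord x) k
        simp only [mean, coord, Submodule.coe_smul, BoundedContinuousFunction.coe_smul, smul_eq_mul,
          ← Finset.mul_sum]
        ring }
    1 (by
      intro x
      rw [one_mul]
      refine (BoundedContinuousFunction.norm_le (norm_nonneg _)).2 fun k => ?_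
      exact norm_mean_le (fun j => (x : ℕ →ᵇ ℂ).norm_coe_le_norm j) k)

/-- The constant sequence `e_∞ = (1, 1, 1, …)`. -/
def eInf : c := ofTendsto (fun _ => 1) ⟨1, tendsto_const_nhds⟩

/-- The operator `P x = x_0 e_∞`. -/
def P (x : c) : c := coord x 0 • eInf

/-- The set `X` of all `x ∈ c` whose orbit `(T ^ n x)` converges in norm. -/
def X : Set c := {x | ∃ y : c, Tendsto (fun n : ℕ => (T ^ n) x) atTop (𝓝 y)}

/-- The series `∑_{k ≥ 1} (x_k - x_0) / k` converges (possibly only conditionally), that is,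
its partial sums have a limit. -/
def SeriesConverges (x : c) : Prop :=
  ∃ s : ℂ, Tendsto (fun N : ℕ => ∑ k ∈ Finset.Icc 1 N, (coord x k - coord x 0) / (k : ℂ))
    atTop (𝓝 s)

end CesaroSeq

end

namespace CesaroSeq

theorem coord_T (x : c) (k : ℕ) : coord (T x) k = mean (coord x) k := rfl

theorem coord_add (x y : c) (k : ℕ) : coord (x + y) k = coord x k + coord y k := rfl

theorem coord_sub (x y : c) (k : ℕ) : coord (x - y) k = coord x k - coord y k := rfl

theorem coord_ofTendsto (f : ℕ → ℂ) (hf : ∃ l : ℂ, Tendsto f atTop (𝓝 l)) (k : ℕ) :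
    coord (ofTendsto f hf) k = f k := rfl

theorem coord_ext {x y : c} (h : ∀ k, coord x k = coord y k) : x = y :=
  Subtype.ext (BoundedContinuousFunction.ext h)

theorem norm_coord_le (x : c) (k : ℕ) : ‖coord x k‖ ≤ ‖x‖ :=
  (x : ℕ →ᵇ ℂ).norm_coe_le_norm k

theorem norm_le_of_coord {x : c} {M : ℝ} (hM : 0 ≤ M) (h : ∀ k, ‖coord x k‖ ≤ M) : ‖x‖ ≤ M :=
  (BoundedContinuousFunction.norm_le hM).2 h

theorem natCast_add_one_mul_mean (f : ℕ → ℂ) (k : ℕ) :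
    ((k : ℂ) + 1) * mean f k = ∑ j ∈ Finset.range (k + 1), f j := by
  rw [mean, mul_inv_cancel_left₀ (Nat.cast_add_one_ne_zero k)]

theorem mean_zero (f : ℕ → ℂ) : mean f 0 = f 0 := by simp [mean]

theorem mean_succ (f : ℕ → ℂ) (k : ℕ) :
    ((k : ℂ) + 2) * mean f (k + 1) = ((k : ℂ) + 1) * mean f k + f (k + 1) := by
  have h := natCast_add_one_mul_mean f (k + 1)
  rw [Finset.sum_range_succ, ← natCast_add_one_mul_mean] at h
  push_cast at h
  rw [← h]
  ring

/-- The Cesàro mean of `u` is a weighted mean of `(u + T u) / 2`. -/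
theorem sum_weighted_add_mean (u : ℕ → ℂ) (k : ℕ) :
    ∑ j ∈ Finset.range (k + 1), ((j : ℂ) + 1) * (u j + mean u j) =
      ((k : ℂ) + 2) * (((k : ℂ) + 1) * mean u k) := by
  induction k with
  | zero => simp [mean_zero]; ring
  | succ k ih =>
    rw [Finset.sum_range_succ, ih]
    have h := mean_succ u k
    push_cast
    linear_combination (-((k : ℂ) + 2)) * h

theorem norm_T_le_half (u : c) : ‖T u‖ ≤ ‖u + T u‖ / 2 := by
  refine norm_le_of_coord (by positivity) fun k => ?_
  have h := sum_weighted_add_mean (coord u) k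
  have hsum : ∀ k : ℕ, ∑ j ∈ Finset.range (k + 1), ((j : ℝ) + 1) =
      ((k : ℝ) + 1) * ((k : ℝ) + 2) / 2 := by
    intro k
    induction k with
    | zero => simp
    | succ k ih => rw [Finset.sum_range_succ, ih]; push_cast; ring
  have hn : ∀ a : ℕ, ‖(a : ℂ) + 1‖ = (a : ℝ) + 1 := fun a => by
    exact_mod_cast Complex.norm_natCast (a + 1)
  have hn2 : ‖(k : ℂ) + 2‖ = (k : ℝ) + 2 := by
    exact_mod_cast Complex.norm_natCast (k + 2)
  have h1 : ‖∑ j ∈ Finset.range (k + 1), ((j : ℂ) + 1) * (coord u j + mean (coord u) j)‖ ≤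
      ∑ j ∈ Finset.range (k + 1), ((j : ℝ) + 1) * ‖u + T u‖ := by
    refine norm_sum_le_of_le _ fun j _ => ?_
    rw [norm_mul, hn]
    exact mul_le_mul_of_nonneg_left (norm_coord_le (u + T u) j) (by positivity)
  rw [h, norm_mul, norm_mul, hn, hn2, ← Finset.sum_mul, hsum] at h1
  have hk : (0 : ℝ) < ((k : ℝ) + 2) * ((k : ℝ) + 1) := by positivity
  refine le_of_mul_le_mul_left ?_ hk
  rw [coord_T]
  linarith

theorem sum_choose_mul_pow {R : Type*} [CommRing R] (t : R) (n : ℕ) :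
    ∑ i ∈ Finset.range (n + 2), ((n + 1).choose i : R) * ((n + 1 : R) - 2 * i) * t ^ i =
      (n + 1) * (1 + t) ^ n * (1 - t) := by
  have h1 : ∑ i ∈ Finset.range (n + 2), ((n + 1).choose i : R) * t ^ i = (1 + t) ^ (n + 1) := by
    rw [add_comm 1 t, add_pow]
    exact Finset.sum_congr rfl fun i _ => by rw [one_pow]; ring
  have h2 : ∑ i ∈ Finset.range (n + 2), ((n + 1).choose i : R) * i * t ^ i =
      (n + 1) * t * (1 + t) ^ n := by
    rw [Finset.sum_range_succ', add_comm 1 t, add_pow, Finset.mul_sum]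
    simp only [Nat.cast_zero, mul_zero, zero_mul, add_zero]
    refine Finset.sum_congr rfl fun i _ => ?_
    have h : ((n + 1 : ℕ) : R) * (n.choose i : R) = ((n + 1).choose (i + 1) : R) * (i + 1 : ℕ) := by
      exact_mod_cast congrArg (Nat.cast (R := R)) (Nat.add_one_mul_choose_eq n i)
    rw [← h, one_pow]
    push_cast
    ring
  have h3 : ∀ i ∈ Finset.range (n + 2),
      ((n + 1).choose i : R) * ((n + 1 : R) - 2 * i) * t ^ i =
        (n + 1) * (((n + 1).choose i : R) * t ^ i) - 2 * (((n + 1).choose i : R) * i * t ^ i) :=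
    fun i _ => by ring
  rw [Finset.sum_congr rfl h3, Finset.sum_sub_distrib, ← Finset.mul_sum, ← Finset.mul_sum, h1, h2]
  ring

theorem sum_choose_mul_sq (n : ℕ) :
    ∑ i ∈ Finset.range (n + 1), (n.choose i : ℝ) * ((n : ℝ) - 2 * i) ^ 2 = (n : ℝ) * 2 ^ n := by
  have h := congrArg (Polynomial.eval (1 / 2 : ℝ)) (bernsteinPolynomial.variance ℝ n)
  simp only [bernsteinPolynomial, Polynomial.eval_finsetSum] at h
  have h4 : ∀ i ∈ Finset.range (n + 1), (n.choose i : ℝ) * ((n : ℝ) - 2 * i) ^ 2 =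
      4 * 2 ^ n * Polynomial.eval (1 / 2 : ℝ) ((n • Polynomial.X - (i : Polynomial ℝ)) ^ 2 *
        ((n.choose i : Polynomial ℝ) * Polynomial.X ^ i * (1 - Polynomial.X) ^ (n - i))) := by
    intro i hi
    have hi' : i ≤ n := Nat.lt_succ_iff.1 (Finset.mem_range.1 hi)
    have h2 : (2 : ℝ) ^ n = 2 ^ i * 2 ^ (n - i) := by rw [← pow_add, Nat.add_sub_cancel' hi']
    have h3 : ∀ a : ℕ, (2 : ℝ) ^ a * (1 / 2) ^ a = 1 := fun a => by
      rw [← mul_pow]; norm_num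
    simp only [Polynomial.eval_mul, Polynomial.eval_pow, Polynomial.eval_sub, 
      Polynomial.eval_X, Polynomial.eval_natCast, Polynomial.eval_one, nsmul_eq_mul]
    rw [show (1 : ℝ) - 1 / 2 = 1 / 2 by norm_num, h2]
    linear_combination (-(n.choose i : ℝ) * ((n : ℝ) - 2 * i) ^ 2) *
      (h3 i * (2 ^ (n - i) * (1 / 2) ^ (n - i)) + h3 (n - i))
  rw [Finset.sum_congr rfl h4, ← Finset.mul_sum, h]
  simp
  ring

theorem sum_choose_mul_abs_le (n : ℕ) :
    ∑ i ∈ Finset.range (n + 1), (n.choose i : ℝ) * |(n : ℝ) - 2 * i| ≤ √n * 2 ^ n := by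
  refine abs_le_of_sq_le_sq' ?_ (by positivity) |>.2
  have h := Finset.sum_sq_le_sum_mul_sum_of_sq_le_mul (Finset.range (n + 1))
    (r := fun i => (n.choose i : ℝ) * |(n : ℝ) - 2 * i|)
    (f := fun i => (n.choose i : ℝ)) (g := fun i => (n.choose i : ℝ) * ((n : ℝ) - 2 * i) ^ 2)
    (fun _ _ => by positivity) (fun _ _ => by positivity)
    (fun i _ => by rw [mul_pow, sq_abs]; exact (by ring : _ = _).le)
  refine h.trans_eq ?_
  have h0 : ∑ i ∈ Finset.range (n + 1), (n.choose i : ℝ) = 2 ^ n := by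
    exact_mod_cast Nat.sum_range_choose n
  rw [sum_choose_mul_sq, mul_pow, Real.sq_sqrt (Nat.cast_nonneg n), h0]
  ring

theorem add_one_smul_one_add_pow_mul {R : Type*} [Ring R] (t : R) (n : ℕ) :
    ((n : R) + 1) * (1 + t) ^ n * (1 - t) =
      ∑ i ∈ Finset.range (n + 2), ((n + 1).choose i : R) * ((n + 1 : R) - 2 * i) * t ^ i := by
  have h := congrArg (Polynomial.aeval t) (sum_choose_mul_pow (Polynomial.X : Polynomial ℤ) n)
  simp only [map_sum, map_mul, map_pow, map_sub, map_add, map_natCast, map_one, map_ofNat,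
    Polynomial.aeval_X] at h
  exact h.symm

theorem norm_one_add_pow_mul_one_sub_le {R : Type*} [NormedRing R] [NormedAlgebra ℂ R] {t : R}
    (ht : ∀ i : ℕ, ‖t ^ i‖ ≤ 1) (n : ℕ) :
    ‖(1 + t) ^ n * (1 - t)‖ ≤ 2 ^ (n + 1) / √((n : ℝ) + 1) := by
  have hs : (0 : ℝ) < √((n : ℝ) + 1) := Real.sqrt_pos.2 (by positivity)
  have h2 : ((n : ℂ) + 1) • ((1 + t) ^ n * (1 - t)) =
      ∑ i ∈ Finset.range (n + 2),
        (((n + 1).choose i : ℂ) * ((n + 1 : ℂ) - 2 * i)) • t ^ i := by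
    have h := add_one_smul_one_add_pow_mul t n
    rw [mul_assoc] at h
    simp only [Algebra.smul_def, map_add, map_mul, map_sub, map_natCast, map_one, map_ofNat]
    exact h
  have h3 := sum_choose_mul_abs_le (n + 1)
  push_cast at h3
  have h1 : ‖((n : ℂ) + 1) • ((1 + t) ^ n * (1 - t))‖ ≤ √((n : ℝ) + 1) * 2 ^ (n + 1) := by
    rw [h2]
    refine le_trans (norm_sum_le_of_le _ fun i _ => ?_) h3
    rw [norm_smul, norm_mul, Complex.norm_natCast]
    have h4 : ‖((n : ℂ) + 1) - 2 * i‖ = |((n : ℝ) + 1) - 2 * i| := by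
      rw [← Real.norm_eq_abs, ← Complex.norm_real]
      push_cast
      rfl
    rw [h4]
    exact mul_le_of_le_one_right (by positivity) (ht i)
  have hn : ‖(n : ℂ) + 1‖ = (n : ℝ) + 1 := by exact_mod_cast Complex.norm_natCast (n + 1)
  rw [norm_smul, hn] at h1
  rw [le_div_iff₀ hs, mul_comm]
  have hsq : √((n : ℝ) + 1) * √((n : ℝ) + 1) = n + 1 := Real.mul_self_sqrt (by positivity)
  refine le_of_mul_le_mul_left ?_ hs
  rw [← mul_assoc, hsq]
  exact h1

section Operator

variable {E : Type*} [NormedAddCommGroup E] [NormedSpace ℂ E] {B : E →L[ℂ] E}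

theorem norm_pow_apply_le_of_norm_le_one (hB : ‖B‖ ≤ 1) (n : ℕ) (u : E) : ‖(B ^ n) u‖ ≤ ‖u‖ := by
  induction n with
  | zero => rfl
  | succ n ih =>
    rw [pow_succ']
    exact ((B.le_opNorm _).trans (mul_le_of_le_one_left (norm_nonneg _) hB)).trans ih

theorem norm_pow_apply_le_one_add_pow (hB : ∀ u, ‖B u‖ ≤ ‖u + B u‖ / 2) (n : ℕ) (u : E) :
    ‖(B ^ n) u‖ ≤ ‖((1 + B) ^ n) u‖ / 2 ^ n := by
  induction n generalizing u with
  | zero => simp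
  | succ n ih =>
    have hc : B ^ n * (1 + B) = (1 + B) * B ^ n :=
      ((Commute.one_right B).add_right (Commute.refl B)).pow_left n
    calc ‖(B ^ (n + 1)) u‖ = ‖B ((B ^ n) u)‖ := by rw [pow_succ']; rfl
      _ ≤ ‖((1 + B) * B ^ n) u‖ / 2 := hB _
      _ = ‖(B ^ n) ((1 + B) u)‖ / 2 := by rw [← hc]; rfl
      _ ≤ ‖((1 + B) ^ n) ((1 + B) u)‖ / 2 ^ n / 2 := by gcongr; exact ih _
      _ = ‖((1 + B) ^ (n + 1)) u‖ / 2 ^ (n + 1) := by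
        rw [pow_succ (1 + B), pow_succ (2 : ℝ), div_div]; rfl

theorem norm_pow_apply_sub_le (hB : ‖B‖ ≤ 1) (hB2 : ∀ u, ‖B u‖ ≤ ‖u + B u‖ / 2) (n : ℕ) (u : E) :
    ‖(B ^ n) (u - B u)‖ ≤ 2 / √((n : ℝ) + 1) * ‖u‖ := by
  have hp : ∀ i : ℕ, ‖B ^ i‖ ≤ 1 := fun i =>
    ContinuousLinearMap.opNorm_le_bound _ zero_le_one fun u => by
      rw [one_mul]; exact norm_pow_apply_le_of_norm_le_one hB i u
  have h := norm_one_add_pow_mul_one_sub_le hp n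
  calc ‖(B ^ n) (u - B u)‖ ≤ ‖((1 + B) ^ n) (u - B u)‖ / 2 ^ n :=
        norm_pow_apply_le_one_add_pow hB2 n _
    _ ≤ (2 ^ (n + 1) / √((n : ℝ) + 1) * ‖u‖) / 2 ^ n := by
        gcongr
        exact (((1 + B) ^ n * (1 - B)).le_opNorm u).trans
          (mul_le_mul_of_nonneg_right h (norm_nonneg _))
    _ = _ := by
        rw [pow_succ]
        field_simp

theorem tendsto_pow_apply_sub (hB : ‖B‖ ≤ 1) (hB2 : ∀ u, ‖B u‖ ≤ ‖u + B u‖ / 2) (u : E) :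
    Tendsto (fun n : ℕ => (B ^ n) (u - B u)) atTop (𝓝 0) := by
  refine squeeze_zero_norm (fun n => norm_pow_apply_sub_le hB hB2 n u) ?_
  have h : Tendsto (fun n : ℕ => √((n : ℝ) + 1)) atTop atTop :=
    Real.tendsto_sqrt_atTop.comp (tendsto_atTop_add_const_right _ 1 tendsto_natCast_atTop_atTop)
  simpa using (h.const_div_atTop 2).mul_const ‖u‖

/-- An eigenvector of the adjoint of `B` gives a lower bound for `‖B ^ n (1 - B)‖`. -/
theorem le_of_eigenfunctional {φ : E →L[ℂ] ℂ} (hφ : φ ≠ 0) {l : ℂ} (h : ∀ u, φ (B u) = l * φ u)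
    {n : ℕ} {M : ℝ} (hM : ∀ u, ‖(B ^ n) (u - B u)‖ ≤ M * ‖u‖) :
    ‖l‖ ^ n * ‖1 - l‖ ≤ M := by
  have hpow : ∀ (n : ℕ) u, φ ((B ^ n) u) = l ^ n * φ u := by
    intro n
    induction n with
    | zero => simp
    | succ n ih =>
      intro u
      rw [pow_succ, mul_apply_eq_comp, ih, h, pow_succ, mul_assoc]
  have hn : 0 < ‖φ‖ := norm_pos_iff.2 hφ
  have h0 : 0 < ‖l‖ ^ n * ‖1 - l‖ ∨ ‖l‖ ^ n * ‖1 - l‖ = 0 := 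
    (show 0 ≤ ‖l‖ ^ n * ‖1 - l‖ by positivity).lt_or_eq.imp_right Eq.symm
  obtain ⟨v, hv⟩ : ∃ v, φ v ≠ 0 := by
    by_contra! hc
    exact hφ (ContinuousLinearMap.ext hc)
  have hM0 : 0 ≤ M := by
    have hv0 : 0 < ‖v‖ := norm_pos_iff.2 fun h => hv (by rw [h, map_zero])
    exact nonneg_of_mul_nonneg_left ((norm_nonneg _).trans (hM v)) hv0
  rcases h0 with h0 | h0
  · have hle : ‖φ‖ ≤ ‖φ‖ * M / (‖l‖ ^ n * ‖1 - l‖) := by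
      refine φ.opNorm_le_bound (by positivity) fun u => ?_
      rw [div_mul_eq_mul_div, le_div_iff₀ h0]
      have h1 : φ ((B ^ n) (u - B u)) = l ^ n * (1 - l) * φ u := by
        rw [hpow, map_sub, h]; ring
      calc ‖φ u‖ * (‖l‖ ^ n * ‖1 - l‖) = ‖φ ((B ^ n) (u - B u))‖ := by
            rw [h1, norm_mul, norm_mul, norm_pow]; ring
        _ ≤ ‖φ‖ * ‖(B ^ n) (u - B u)‖ := φ.le_opNorm _
        _ ≤ ‖φ‖ * (M * ‖u‖) := by gcongr; exact hM u
        _ = _ := by ring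
    rw [le_div_iff₀ h0] at hle
    exact le_of_mul_le_mul_left hle hn
  · rwa [h0]

end Operator

theorem norm_T_le_one : ‖T‖ ≤ 1 := LinearMap.mkContinuous_norm_le _ zero_le_one _

theorem norm_T_pow_apply_le (n : ℕ) (u : c) : ‖(T ^ n) u‖ ≤ ‖u‖ :=
  norm_pow_apply_le_of_norm_le_one norm_T_le_one n u

theorem tendsto_T_pow_sub (y : c) : Tendsto (fun n : ℕ => (T ^ n) (y - T y)) atTop (𝓝 0) :=
  tendsto_pow_apply_sub norm_T_le_one norm_T_le_half y

/-- The functional on `c` given by a summable sequence. -/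
noncomputable def pairing (φ : ℕ → ℂ) (hφ : Summable fun j => ‖φ j‖) : c →L[ℂ] ℂ :=
  have hb : ∀ (x : c) (j : ℕ), ‖φ j * coord x j‖ ≤ ‖φ j‖ * ‖x‖ := fun x j => by
    rw [norm_mul]
    exact mul_le_mul_of_nonneg_left (norm_coord_le x j) (norm_nonneg _)
  have hs : ∀ x : c, Summable fun j => φ j * coord x j := fun x =>
    Summable.of_norm_bounded (hφ.mul_right _) (hb x)
  LinearMap.mkContinuous
    { toFun := fun x => ∑' j, φ j * coord x j
      map_add' := fun x y => by
        rw [← (hs x).tsum_add (hs y)]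
        exact tsum_congr fun j => by rw [coord_add, mul_add]
      map_smul' := fun t x => by
        rw [RingHom.id_apply, smul_eq_mul, ← tsum_mul_left]
        refine tsum_congr fun j => ?_
        change φ j * (t * coord x j) = _
        ring }
    (∑' j, ‖φ j‖) fun x => by
      rw [← tsum_mul_right]
      exact tsum_of_norm_bounded (hφ.mul_right _).hasSum (hb x)

theorem hasSum_pairing {φ : ℕ → ℂ} (hφ : Summable fun j => ‖φ j‖) (x : c) :
    HasSum (fun j => φ j * coord x j) (pairing φ hφ x) :=
  (Summable.of_norm_bounded (hφ.mul_right ‖x‖) fun j => by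
    rw [norm_mul]
    exact mul_le_mul_of_nonneg_left (norm_coord_le x j) (norm_nonneg _)).hasSum

/-- The sequence `∏_{1 ≤ i ≤ j} (1 - w / i)`, an eigenvector of the adjoint of `T` for the
eigenvalue `w⁻¹` when `1 < re w`. -/
noncomputable def adjointEigen (w : ℂ) (j : ℕ) : ℂ :=
  ∏ i ∈ Finset.range j, (1 - w / ((i : ℂ) + 1))

theorem adjointEigen_succ (w : ℂ) (j : ℕ) :
    ((j : ℂ) + 1) * adjointEigen w (j + 1) = ((j : ℂ) + 1 - w) * adjointEigen w j := by
  have := Nat.cast_add_one_ne_zero (R := ℂ) j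
  rw [adjointEigen, Finset.prod_range_succ, ← adjointEigen]
  field_simp

theorem sum_adjointEigen_mul (w : ℂ) (f : ℕ → ℂ) (N : ℕ) :
    ∑ j ∈ Finset.range (N + 1), adjointEigen w j * f j =
      adjointEigen w N * (N + 1) * mean f N +
        w * ∑ j ∈ Finset.range N, adjointEigen w j * mean f j := by
  induction N with
  | zero => simp [mean_zero]
  | succ N ih =>
    rw [Finset.sum_range_succ, ih, Finset.sum_range_succ _ N]
    have h1 := mean_succ f N
    have h2 := adjointEigen_succ w N
    push_cast
    linear_combination (-adjointEigen w (N + 1)) * h1 - mean f N * h2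

theorem exists_norm_adjointEigen_le {w : ℂ} (hw : 1 < w.re) :
    ∃ p : ℝ, 1 < p ∧ ∃ C : ℝ, ∀ᶠ k : ℕ in atTop, ‖adjointEigen w k‖ * (k : ℝ) ^ p ≤ C := by
  set p : ℝ := (1 + w.re) / 2 with hp
  have hp1 : 1 < p := by rw [hp]; linarith
  have hpw : 0 < w.re - p := by rw [hp]; linarith
  obtain ⟨J, hJ⟩ := exists_nat_ge (max (w.re + p) (w.im ^ 2 / (w.re - p)))
  have hJ1 := (le_max_left _ _).trans hJ
  have hJ2 := (le_max_right _ _).trans hJ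
  rw [div_le_iff₀ hpw] at hJ2
  have hstep : ∀ k : ℕ, J ≤ k →
      ‖adjointEigen w (k + 1)‖ * ((k + 1 : ℕ) : ℝ) ^ p ≤ ‖adjointEigen w k‖ * (k : ℝ) ^ p := by
    intro k hk
    have hkJ : (J : ℝ) ≤ k := Nat.cast_le.2 hk
    have hk0 : (0 : ℝ) < (k : ℝ) + 1 := by positivity
    have h1 : ‖(k : ℂ) + 1 - w‖ ≤ (k : ℝ) + 1 - p := by
      refine abs_le_of_sq_le_sq' ?_ (by linarith) |>.2
      rw [← Complex.normSq_eq_norm_sq, Complex.normSq_apply]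
      simp only [Complex.sub_re, Complex.add_re, Complex.natCast_re, Complex.one_re,
        Complex.sub_im, Complex.add_im, Complex.natCast_im, Complex.one_im]
      nlinarith
    have h2 : (k : ℝ) + 1 - p ≤ ((k : ℝ) + 1) * ((k : ℝ) / (k + 1)) ^ p := by
      have hs : -1 ≤ -((k : ℝ) + 1)⁻¹ := by
        rw [neg_le_neg_iff]
        exact inv_le_one_of_one_le₀ (by linarith [Nat.cast_nonneg (α := ℝ) k])
      have h := one_add_mul_self_le_rpow_one_add hs hp1.le
      have he : 1 + -((k : ℝ) + 1)⁻¹ = (k : ℝ) / (k + 1) := by field_simp; ring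
      rw [he] at h
      calc (k : ℝ) + 1 - p = ((k : ℝ) + 1) * (1 + p * -((k : ℝ) + 1)⁻¹) := by field_simp; ring
        _ ≤ _ := mul_le_mul_of_nonneg_left h hk0.le
    have h3 : ((k : ℝ) + 1) * ‖adjointEigen w (k + 1)‖ =
        ‖(k : ℂ) + 1 - w‖ * ‖adjointEigen w k‖ := by
      have h := congrArg norm (adjointEigen_succ w k)
      have hn : ‖(k : ℂ) + 1‖ = (k : ℝ) + 1 := by exact_mod_cast Complex.norm_natCast (k + 1)
      rwa [norm_mul, norm_mul, hn] at h
    have h4 : ‖adjointEigen w (k + 1)‖ ≤ ‖adjointEigen w k‖ * ((k : ℝ) / (k + 1)) ^ p := by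
      refine le_of_mul_le_mul_left ?_ hk0
      rw [h3]
      calc _ ≤ ((k : ℝ) + 1) * ((k : ℝ) / (k + 1)) ^ p * ‖adjointEigen w k‖ := by
            gcongr; exact h1.trans h2
        _ = _ := by ring
    rw [Real.div_rpow (Nat.cast_nonneg k) hk0.le, ← mul_div_assoc,
      le_div_iff₀ (Real.rpow_pos_of_pos hk0 p)] at h4
    push_cast
    exact h4
  refine ⟨p, hp1, ‖adjointEigen w J‖ * (J : ℝ) ^ p, eventually_atTop.2 ⟨J, fun k hk => ?_⟩⟩
  induction k, hk using Nat.le_induction with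
  | base => exact le_rfl
  | succ k hk ih => exact (hstep k hk).trans ih

theorem summable_norm_adjointEigen {w : ℂ} (hw : 1 < w.re) :
    Summable fun j => ‖adjointEigen w j‖ := by
  obtain ⟨p, hp, C, hC⟩ := exists_norm_adjointEigen_le hw
  refine Summable.of_norm_bounded_eventually_nat
    ((Real.summable_nat_rpow_inv.2 hp).mul_left C) ?_
  filter_upwards [hC, eventually_gt_atTop 0] with k hk hk0
  have : (0 : ℝ) < (k : ℝ) ^ p := Real.rpow_pos_of_pos (Nat.cast_pos.2 hk0) p
  rw [norm_norm, ← div_eq_mul_inv, le_div_iff₀ this]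
  exact hk

theorem tendsto_adjointEigen_mul {w : ℂ} (hw : 1 < w.re) :
    Tendsto (fun k : ℕ => adjointEigen w k * (k + 1)) atTop (𝓝 0) := by
  obtain ⟨p, hp, C, hC⟩ := exists_norm_adjointEigen_le hw
  have hlim : Tendsto (fun k : ℕ => 2 * C * (k : ℝ) ^ (-(p - 1))) atTop (𝓝 0) := by
    simpa using ((tendsto_rpow_neg_atTop (sub_pos.2 hp)).comp
      tendsto_natCast_atTop_atTop).const_mul (2 * C)
  refine squeeze_zero_norm' ?_ hlim
  filter_upwards [hC, eventually_gt_atTop 0] with k hk hk0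
  have hk1 : (1 : ℝ) ≤ k := Nat.one_le_cast.2 hk0
  have hk2 : (0 : ℝ) < k := by linarith
  have hn : ‖(k : ℂ) + 1‖ = (k : ℝ) + 1 := by exact_mod_cast Complex.norm_natCast (k + 1)
  have hpw : (k : ℝ) ^ p * (k : ℝ) ^ (-(p - 1)) = k := by
    rw [← Real.rpow_add hk2, show p + -(p - 1) = 1 by ring, Real.rpow_one]
  have h0 : (0 : ℝ) ≤ (k : ℝ) ^ (-(p - 1)) := (Real.rpow_pos_of_pos hk2 _).le
  rw [norm_mul, hn]
  calc ‖adjointEigen w k‖ * ((k : ℝ) + 1) ≤ ‖adjointEigen w k‖ * (2 * k) := by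
        gcongr; linarith
    _ = 2 * (‖adjointEigen w k‖ * (k : ℝ) ^ p) * (k : ℝ) ^ (-(p - 1)) := by
        nth_rw 1 [← hpw]; ring
    _ ≤ _ := by gcongr

theorem pairing_adjointEigen_T {w : ℂ} (hw : 1 < w.re) (x : c) :
    pairing (adjointEigen w) (summable_norm_adjointEigen hw) (T x) =
      w⁻¹ * pairing (adjointEigen w) (summable_norm_adjointEigen hw) x := by
  have hw0 : w ≠ 0 := fun h => by norm_num [h] at hw
  have h1 := (hasSum_pairing (summable_norm_adjointEigen hw) x).tendsto_sum_nat
  have h2 := (hasSum_pairing (summable_norm_adjointEigen hw) (T x)).tendsto_sum_nat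
  obtain ⟨l, hl⟩ := (T x).2
  have h3 := ((tendsto_adjointEigen_mul hw).mul hl).add (h2.const_mul w)
  have h4 := (tendsto_add_atTop_iff_nat 1).2 h1
  have h5 := tendsto_nhds_unique h4
    (h3.congr fun N => (sum_adjointEigen_mul w (coord x) N).symm)
  rw [h5, zero_mul, zero_add, inv_mul_cancel_left₀ hw0]

theorem pairing_adjointEigen_ne_zero {w : ℂ} (hw : 1 < w.re) :
    pairing (adjointEigen w) (summable_norm_adjointEigen hw) ≠ 0 := by
  intro h
  let e : c := ofTendsto (Pi.single 0 1) ⟨0, tendsto_const_nhds.congr'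
    ((eventually_gt_atTop 0).mono fun k hk => by rw [Pi.single_eq_of_ne hk.ne'])⟩
  have h1 := hasSum_pairing (summable_norm_adjointEigen hw) e
  have h2 : HasSum (fun j => adjointEigen w j * coord e j) (adjointEigen w 0 * coord e 0) :=
    hasSum_single 0 fun j hj => by
      rw [coord_ofTendsto, Pi.single_eq_of_ne hj, mul_zero]
  have h3 := h1.unique h2
  rw [h, coord_ofTendsto, Pi.single_eq_same] at h3
  simp [adjointEigen] at h3

theorem norm_sub_one_le_of_norm_T_pow_le {w : ℂ} (hw : 1 < w.re) {n : ℕ} {M : ℝ}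
    (hM : ∀ u, ‖(T ^ n) (u - T u)‖ ≤ M * ‖u‖) : ‖w - 1‖ ≤ M * ‖w‖ ^ (n + 1) := by
  have hw0 : w ≠ 0 := fun h => by norm_num [h] at hw
  have h := le_of_eigenfunctional (pairing_adjointEigen_ne_zero hw) (pairing_adjointEigen_T hw) hM
  have hn : 0 < ‖w‖ := norm_pos_iff.2 hw0
  have h1 : ‖1 - w⁻¹‖ = ‖w - 1‖ / ‖w‖ := by
    rw [← norm_div]; congr 1; field_simp
  rw [h1, norm_inv] at h
  calc ‖w - 1‖ = ‖w‖⁻¹ ^ n * (‖w - 1‖ / ‖w‖) * ‖w‖ ^ (n + 1) := by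
        rw [pow_succ, inv_pow]; field_simp
    _ ≤ _ := by gcongr

theorem rpow_neg_half_le_of_norm_T_pow_le {n : ℕ} (hn : 0 < n) {M : ℝ}
    (hM : ∀ u, ‖(T ^ n) (u - T u)‖ ≤ M * ‖u‖) :
    (n : ℝ) ^ (-(1 / 2) : ℝ) ≤ Real.exp 4 * M := by
  have hn1 : (1 : ℝ) ≤ n := Nat.one_le_cast.2 hn
  have hn0 : (0 : ℝ) < n := by linarith
  set τ : ℝ := (n : ℝ) ^ (-(1 / 2) : ℝ) with hτ
  have hτ0 : 0 < τ := Real.rpow_pos_of_pos hn0 _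
  have hτ2 : τ ^ 2 = 1 / n := by
    rw [hτ, ← Real.rpow_natCast, ← Real.rpow_mul hn0.le]
    norm_num
    exact Real.rpow_neg_one _
  set w : ℂ := ⟨1 + 1 / n, τ⟩ with hw
  have hre : 1 < w.re := by
    change 1 < 1 + 1 / (n : ℝ)
    have : 0 < 1 / (n : ℝ) := by positivity
    linarith
  have h := norm_sub_one_le_of_norm_T_pow_le hre hM
  have h1 : τ ≤ ‖w - 1‖ := by
    have := Complex.abs_im_le_norm (w - 1)
    rw [Complex.sub_im, Complex.one_im, sub_zero] at this
    exact (le_abs_self _).trans this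
  have h2 : ‖w‖ ≤ 1 + 2 / n := by
    refine abs_le_of_sq_le_sq' ?_ (by positivity) |>.2
    rw [← Complex.normSq_eq_norm_sq, Complex.normSq_apply]
    change (1 + 1 / (n : ℝ)) * (1 + 1 / (n : ℝ)) + τ * τ ≤ _
    have : 0 < 1 / (n : ℝ) := by positivity
    have h2n : (2 : ℝ) / n = 2 * (1 / n) := by ring
    rw [← sq τ, hτ2, h2n]
    nlinarith
  have h3 : ‖w‖ ^ (n + 1) ≤ Real.exp 4 := by
    calc ‖w‖ ^ (n + 1) ≤ (Real.exp (2 / n)) ^ (n + 1) := by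
          refine pow_le_pow_left₀ (norm_nonneg _) (h2.trans ?_) _
          rw [add_comm]; exact Real.add_one_le_exp _
      _ = Real.exp (((n + 1 : ℕ) : ℝ) * (2 / n)) := (Real.exp_nat_mul _ _).symm
      _ ≤ _ := by
        refine Real.exp_le_exp.2 ?_
        push_cast
        rw [← mul_div_assoc, div_le_iff₀ hn0]
        linarith
  have hM0 : 0 ≤ M := by
    by_contra! hneg
    have : M * ‖w‖ ^ (n + 1) ≤ 0 := mul_nonpos_of_nonpos_of_nonneg hneg.le (by positivity)
    linarith
  calc τ ≤ M * ‖w‖ ^ (n + 1) := h1.trans h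
    _ ≤ M * Real.exp 4 := by gcongr
    _ = _ := mul_comm _ _

theorem coord_T_zero (x : c) : coord (T x) 0 = coord x 0 := mean_zero _

theorem tendsto_coord_T {x : c} {l : ℂ} (h : Tendsto (coord x) atTop (𝓝 l)) :
    Tendsto (coord (T x)) atTop (𝓝 l) := tendsto_mean h

theorem tendsto_coord_T_pow {x : c} {l : ℂ} (h : Tendsto (coord x) atTop (𝓝 l)) (n : ℕ) :
    Tendsto (coord ((T ^ n) x)) atTop (𝓝 l) := by
  induction n with
  | zero => exact h
  | succ n ih => rw [pow_succ']; exact tendsto_coord_T ih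

theorem P_eq_zero {x : c} (h : coord x 0 = 0) : P x = 0 := by rw [P, h, zero_smul]

theorem exists_sub_T_eq {x : c} (h0 : coord x 0 = 0)
    (hs : ∃ s, Tendsto (fun N : ℕ => ∑ j ∈ Finset.range (N + 1), coord x j / (j : ℂ))
      atTop (𝓝 s)) : ∃ y, y - T y = x := by
  obtain ⟨l, hl⟩ := x.2
  obtain ⟨s, hs⟩ := hs
  set m : ℕ → ℂ := fun N => ∑ j ∈ Finset.range (N + 1), coord x j / (j : ℂ) with hm
  have hlim : Tendsto (fun k => coord x k + m k) atTop (𝓝 (l + s)) := Tendsto.add hl hs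
  refine ⟨ofTendsto _ ⟨_, hlim⟩, coord_ext fun k => ?_⟩
  have hsum : ∀ k : ℕ, ∑ j ∈ Finset.range (k + 1), (coord x j + m j) = ((k : ℂ) + 1) * m k := by
    intro k
    induction k with
    | zero => simp [hm, h0]
    | succ k ih =>
      have hk := Nat.cast_add_one_ne_zero (R := ℂ) k
      have hmk : m (k + 1) = m k + coord x (k + 1) / ((k : ℂ) + 1) := by
        rw [hm]
        simp only
        rw [Finset.sum_range_succ _ (k + 1), Nat.cast_add_one]
      rw [Finset.sum_range_succ, ih, hmk]
      push_cast
      field_simp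
      ring
  rw [coord_sub, coord_T, coord_ofTendsto]
  have hmean : mean (coord (ofTendsto (fun k => coord x k + m k) ⟨_, hlim⟩)) k = m k := by
    change mean (fun k => coord x k + m k) k = m k
    rw [mean, hsum, inv_mul_cancel_left₀ (Nat.cast_add_one_ne_zero k)]
  rw [hmean, add_sub_cancel_right]

theorem tendsto_T_pow_zero {x : c} (h0 : coord x 0 = 0) (h : Tendsto (coord x) atTop (𝓝 0)) :
    Tendsto (fun n : ℕ => (T ^ n) x) atTop (𝓝 0) := by
  rw [Metric.tendsto_atTop]
  intro ε hε
  obtain ⟨N, hN⟩ := Metric.tendsto_atTop.1 h (ε / 3) (by positivity)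
  have hz : ∀ k, N ≤ k → (if k < N then coord x k else 0) = 0 := fun k hk => if_neg hk.not_gt
  let t : c := ofTendsto (fun k => if k < N then coord x k else 0)
    ⟨0, tendsto_const_nhds.congr' ((eventually_ge_atTop N).mono fun k hk => (hz k hk).symm)⟩
  have ht : ∀ k, coord t k = if k < N then coord x k else 0 := fun _ => rfl
  obtain ⟨y, hy⟩ : ∃ y, y - T y = t := by
    refine exists_sub_T_eq (by rw [ht, h0, ite_self]) ⟨_, tendsto_const_nhds.congr' <|
      (eventually_ge_atTop N).mono fun k hk => (Finset.sum_subset (s₁ := Finset.range N)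
        (Finset.range_mono (by omega)) fun j _ hj => ?_)⟩
    rw [ht, hz j (by simpa using hj), zero_div]
  have hxt : ‖x - t‖ ≤ ε / 3 := norm_le_of_coord (by positivity) fun k => by
    rw [coord_sub, ht]
    split_ifs with hk
    · rw [sub_self, norm_zero]; positivity
    · rw [← dist_eq_norm]; exact (hN k (not_lt.1 hk)).le
  obtain ⟨n₀, hn₀⟩ := Metric.tendsto_atTop.1 (tendsto_T_pow_sub y) (ε / 3) (by positivity)
  refine ⟨n₀, fun n hn => ?_⟩
  have h1 := hn₀ n hn
  rw [hy, dist_zero_right] at h1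
  have h2 : (T ^ n) x = (T ^ n) (x - t) + (T ^ n) t := by rw [← map_add, sub_add_cancel]
  rw [dist_zero_right, h2]
  have := norm_add_le ((T ^ n) (x - t)) ((T ^ n) t)
  have := norm_T_pow_apply_le n (x - t)
  linarith

theorem seriesConverges_sub_T (y : c) : SeriesConverges (y - T y) := by
  obtain ⟨l, hl⟩ := (T y).2
  refine ⟨l - coord (T y) 0, (Tendsto.sub_const hl _).congr fun N => ?_⟩
  change coord (T y) N - _ = _
  have h0 : coord (y - T y) 0 = 0 := by rw [coord_sub, coord_T_zero, sub_self]
  rw [h0]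
  induction N with
  | zero => simp
  | succ N ih =>
    rw [Finset.sum_Icc_succ_top (by omega), ← ih, coord_sub]
    have hN := Nat.cast_add_one_ne_zero (R := ℂ) N
    have h := mean_succ (coord y) N
    rw [← coord_T, ← coord_T] at h
    push_cast
    field_simp
    linear_combination h

theorem isClosed_c : IsClosed (c : Set (ℕ →ᵇ ℂ)) := by
  refine isClosed_of_closure_subset fun x hx => ?_
  refine cauchySeq_tendsto_of_complete (Metric.cauchySeq_iff'.2 fun ε hε => ?_)
  obtain ⟨y, ⟨l, hl⟩, hxy⟩ := Metric.mem_closure_iff.1 hx (ε / 3) (by positivity)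
  obtain ⟨N, hN⟩ := Metric.cauchySeq_iff'.1 hl.cauchySeq (ε / 3) (by positivity)
  refine ⟨N, fun n hn => ?_⟩
  have h1 := (BoundedContinuousFunction.dist_coe_le_dist (f := x) (g := y) n).trans_lt hxy
  have h2 := (BoundedContinuousFunction.dist_coe_le_dist (f := x) (g := y) N).trans_lt hxy
  have h3 := hN n hn
  have h4 := dist_triangle4 (x n) (y n) (y N) (x N)
  rw [dist_comm (y N) (x N)] at h4
  linarith

instance : CompleteSpace c := isClosed_c.completeSpace_coe

theorem limsup_coe_eq_top_of_not_bddAbove {f : ℕ → ℝ} (hf : ¬ BddAbove (Set.range f)) :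
    limsup (fun n => ((f n : ℝ) : EReal)) atTop = ⊤ := by
  by_contra h
  obtain ⟨C, hC, -⟩ := EReal.lt_iff_exists_real_btwn.1 (lt_top_iff_ne_top.2 h)
  have hev := eventually_lt_of_limsup_lt hC
  refine hf (IsBoundedUnder.bddAbove_range ⟨C, ?_⟩)
  rw [eventually_map]
  exact hev.mono fun n hn => (EReal.coe_lt_coe_iff.1 hn).le

theorem exists_unbounded_orbit {r : ℕ → ℝ} (hr : ∀ n, 0 < r n)
    (ho : r =o[atTop] fun n : ℕ => (n : ℝ) ^ (-(1 / 2) : ℝ)) :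
    ∃ y : c, ¬ BddAbove (Set.range fun n => (r n)⁻¹ * ‖(T ^ n) (y - T y)‖) := by
  by_contra! hall
  let g : ℕ → c →L[ℂ] c := fun n => (((r n)⁻¹ : ℝ) : ℂ) • (T ^ n - T ^ n * T)
  have hg : ∀ n y, ‖g n y‖ = (r n)⁻¹ * ‖(T ^ n) (y - T y)‖ := fun n y => by
    have h1 : g n y = (((r n)⁻¹ : ℝ) : ℂ) • ((T ^ n) (y - T y)) := by rw [map_sub]; rfl
    rw [h1, norm_smul, Complex.norm_real, Real.norm_of_nonneg (inv_nonneg.2 (hr n).le)]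
  obtain ⟨C, hC⟩ := banach_steinhaus (g := g) fun y => by
    obtain ⟨C, hC⟩ := hall y
    exact ⟨C, fun n => (hg n y).trans_le (hC ⟨n, rfl⟩)⟩
  have hC0 : 0 ≤ C := (norm_nonneg _).trans (hC 0)
  have hM : ∀ n u, ‖(T ^ n) (u - T u)‖ ≤ (r n * C) * ‖u‖ := fun n u => by
    have h := (g n).le_of_opNorm_le (hC n) u
    rw [hg, inv_mul_le_iff₀ (hr n)] at h
    rwa [mul_assoc]
  have hD : 0 < Real.exp 4 * C + 1 := by positivity
  obtain ⟨n, h1, hn⟩ := ((ho.def (inv_pos.2 hD)).and (eventually_gt_atTop 0)).exists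
  have h2 := rpow_neg_half_le_of_norm_T_pow_le hn (hM n)
  have h3 : 0 < (n : ℝ) ^ (-(1 / 2) : ℝ) := Real.rpow_pos_of_pos (Nat.cast_pos.2 hn) _
  rw [Real.norm_of_nonneg (hr n).le, Real.norm_of_nonneg h3.le, inv_mul_eq_div,
    le_div_iff₀ hD] at h1
  linarith [hr n, h1, h2]

/-- `T ^ n` preserves the coordinatewise order of real parts, locally in the index. -/
theorem re_coord_T_pow_mono {x y : c} {K : ℕ} (h : ∀ k ≤ K, (coord x k).re ≤ (coord y k).re)
    (n : ℕ) : ∀ k ≤ K, (coord ((T ^ n) x) k).re ≤ (coord ((T ^ n) y) k).re := by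
  induction n with
  | zero => exact h
  | succ n ih =>
    intro k hk
    have hc : ((k : ℂ) + 1)⁻¹ = (((k : ℝ) + 1)⁻¹ : ℝ) := by push_cast; rfl
    rw [pow_succ', mul_apply_eq_comp, mul_apply_eq_comp, coord_T, coord_T, mean, mean, hc,
      Complex.re_ofReal_mul, Complex.re_ofReal_mul, Complex.re_sum, Complex.re_sum]
    refine mul_le_mul_of_nonneg_left (Finset.sum_le_sum fun j hj => ih j ?_) (by positivity)
    have := Finset.mem_range.1 hj
    omega

/-- The sequence `(0, 1, 1, 1, …)`. -/
noncomputable def tailOne : c := ofTendsto (fun k => if k = 0 then 0 else 1)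
  ⟨1, tendsto_const_nhds.congr' ((eventually_gt_atTop 0).mono fun _ hk => (if_neg hk.ne').symm)⟩

theorem tendsto_coord_tailOne : Tendsto (coord tailOne) atTop (𝓝 1) :=
  tendsto_const_nhds.congr' ((eventually_gt_atTop 0).mono fun _ hk => (if_neg hk.ne').symm)

theorem exists_half_le_re_coord_T_pow_tailOne (n : ℕ) :
    ∃ k, 1 / 2 ≤ (coord ((T ^ n) tailOne) k).re := by
  have h := (Complex.continuous_re.tendsto _).comp (tendsto_coord_T_pow tendsto_coord_tailOne n)
  exact ((h.eventually (lt_mem_nhds (show (1 / 2 : ℝ) < (1 : ℂ).re by norm_num))).exists).imp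
    fun _ hk => le_of_lt hk

theorem exists_le_norm_T_pow {r : ℕ → ℝ} (hr : ∀ n, 0 < r n) (hlim : Tendsto r atTop (𝓝 0)) :
    ∃ x : c, coord x 0 = 0 ∧ Tendsto (coord x) atTop (𝓝 0) ∧ ∀ n, r n ≤ ‖(T ^ n) x‖ := by
  choose m hm using exists_half_le_re_coord_T_pow_tailOne
  let s : ℕ → ℝ := fun k => ⨆ n, if k ≤ m n then 2 * r n else 0
  obtain ⟨R, hR⟩ := hlim.bddAbove_range
  have hR' : ∀ n, r n ≤ R := fun n => hR ⟨n, rfl⟩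
  have hbdd : ∀ k, BddAbove (Set.range fun n => if k ≤ m n then 2 * r n else 0) := by
    intro k
    refine ⟨2 * R, ?_⟩
    rintro _ ⟨n, rfl⟩
    have := hR' n
    have := hr n
    simp only
    split_ifs <;> linarith
  have hs1 : ∀ n k, k ≤ m n → 2 * r n ≤ s k := fun n k hk => by
    have h := le_ciSup (hbdd k) n
    rwa [if_pos hk] at h
  have hs0 : ∀ k, 0 ≤ s k := fun k => Real.iSup_nonneg fun n => by
    have := hr n
    split_ifs <;> linarith
  have hslim : Tendsto s atTop (𝓝 0) := by
    refine Metric.tendsto_atTop.2 fun ε hε => ?_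
    obtain ⟨n₀, hn₀⟩ := Metric.tendsto_atTop.1 hlim (ε / 4) (by positivity)
    refine ⟨(Finset.range n₀).sup m + 1, fun k hk => ?_⟩
    rw [Real.dist_0_eq_abs, abs_of_nonneg (hs0 k)]
    refine lt_of_le_of_lt (b := ε / 2) (ciSup_le fun n => ?_) (by linarith)
    split_ifs with hkn
    · have hn : n₀ ≤ n := by
        by_contra! hlt
        have := Finset.le_sup (f := m) (Finset.mem_range.2 hlt)
        omega
      have h := hn₀ n hn
      rw [Real.dist_0_eq_abs, abs_of_pos (hr n)] at h
      linarith
    · positivity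
  have hxlim : Tendsto (fun k => if k = 0 then (0 : ℂ) else (s k : ℂ)) atTop (𝓝 0) := by
    have h := (Complex.continuous_ofReal.tendsto 0).comp hslim
    rw [Complex.ofReal_zero] at h
    exact h.congr' ((eventually_gt_atTop 0).mono fun _ hk => (if_neg hk.ne').symm)
  refine ⟨ofTendsto _ ⟨0, hxlim⟩, rfl, hxlim, fun n => ?_⟩
  have hcmp : ∀ k ≤ m n, (coord (((2 * r n : ℝ) : ℂ) • tailOne) k).re ≤
      (coord (ofTendsto _ ⟨0, hxlim⟩) k).re := by
    intro k hk
    change (((2 * r n : ℝ) : ℂ) * (if k = 0 then 0 else 1)).re ≤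
      (if k = 0 then (0 : ℂ) else (s k : ℂ)).re
    split_ifs with h0
    · simp
    · rw [mul_one, Complex.ofReal_re, Complex.ofReal_re]
      exact hs1 n k hk
  have h1 := re_coord_T_pow_mono hcmp n (m n) le_rfl
  rw [map_smul] at h1
  change (((2 * r n : ℝ) : ℂ) * coord ((T ^ n) tailOne) (m n)).re ≤ _ at h1
  rw [Complex.re_ofReal_mul] at h1
  have h2 := (Complex.re_le_norm _).trans (norm_coord_le ((T ^ n) (ofTendsto _ ⟨0, hxlim⟩)) (m n))
  nlinarith [hm n, hr n]

end CesaroSeq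

theorem proposition3p7 :
    (∀ r : ℕ → ℝ, (∀ n, 0 < r n) →
      r =o[atTop] (fun n : ℕ => (n : ℝ) ^ (-(1 / 2) : ℝ)) →
      ∃ x ∈ CesaroSeq.X, CesaroSeq.SeriesConverges x ∧
        limsup (fun n : ℕ =>
          (((r n)⁻¹ * ‖(CesaroSeq.T ^ n) x - CesaroSeq.P x‖ : ℝ) : EReal)) atTop = ⊤) ∧
    (∀ r : ℕ → ℝ, (∀ n, 0 < r n) → Tendsto r atTop (𝓝 0) →
      ∃ x ∈ CesaroSeq.X, ∀ n : ℕ, r n ≤ ‖(CesaroSeq.T ^ n) x - CesaroSeq.P x‖) := by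
  refine ⟨fun r hr ho => ?_, fun r hr hlim => ?_⟩
  · obtain ⟨y, hy⟩ := CesaroSeq.exists_unbounded_orbit hr ho
    refine ⟨y - CesaroSeq.T y, ⟨0, CesaroSeq.tendsto_T_pow_sub y⟩,
      CesaroSeq.seriesConverges_sub_T y, ?_⟩
    rw [CesaroSeq.P_eq_zero (by rw [CesaroSeq.coord_sub, CesaroSeq.coord_T_zero, sub_self])]
    simp only [sub_zero]
    exact CesaroSeq.limsup_coe_eq_top_of_not_bddAbove hy
  · obtain ⟨x, h0, hx, h⟩ := CesaroSeq.exists_le_norm_T_pow hr hlim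
    refine ⟨x, ⟨0, CesaroSeq.tendsto_T_pow_zero h0 hx⟩, fun n => ?_⟩
    rw [CesaroSeq.P_eq_zero h0, sub_zero]
    exact h n
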